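/- A signed hypergraph $H=(V,S)$ consists of a finite node set $V$ and a finite set $S$ of signed edges $s=(e,\eta_s)$, where $e\subseteq V$, $|e|\ge 2$ and $\eta_s:e\to\{-1,+1\}$. Its underlying hypergraph $G=(V,E)$ has as edges the sets $e$ of the signed edges, and the rank $r$ of $H$ is the maximum cardinality of an edge of $G$. The pseudo-Boolean polytope is $$\mathrm{PBP}(H)=\operatorname{conv}\Big\{z\in\{0,1\}^{V\cup S}: z_s=\prod_{v\in e,\ \eta_s(v)=+1}z_v\prod_{v\in e,\ \eta_s(v)=-1}(1-z_v)\ \ \forall s=(e,\eta_s)\in S\Big\}.$$ For a hypergraph $G=(V,E)$ and $N\subseteq V$, let $G-N$ be the hypergraph with node set $V\setminus N$ and edge set $\{e\setminus N: e\in E,\ |e\setminus N|\ge 2\}$. The set $N$ is a nest-set of $G$ if $\{e\setminus N: e\in E,\ e\cap N\neq\emptyset\}$ is totally ordered by inclusion. A nest-set elimination order of $G$ is a sequence $N_1,\dots,N_t$ of pairwise disjoint sets with union $V$ such that $N_i$ is a nest-set of $G-N_1-\dots-N_{i-1}$ for all $i$; its width is $\max_i|N_i|$, and $\mathrm{nsw}(G)$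 is the minimum width of a nest-set elimination order of $G$. An extended formulation of a polytope $P$ is a finite system of linear inequalities $Ax+By\le b$ such that $P=\{x:\exists y,\ Ax+By\le b\}$; its variables are all coordinates of $x$ and $y$. **Corollary.** There is an absolute constant $C$ such that the following holds. Let $H=(V,S)$ be a signed hypergraph of rank $r$ with $S\ne\emptyset$, whose underlying hypergraph $G=(V,E)$ satisfies $\mathrm{nsw}(G)\le k$. Then $\mathrm{PBP}(H)$ has an extended formulation with at most $C\,r\,2^k|V||S|$ variables and at most $C\,r\,2^k|V||S|$ inequalities, in which all coefficients and right-hand side constants are $0,\pm1$. In particular, $\mathrm{PBP}(H)$ has a polynomial-size extended formulation if $k\in O(\log\mathrm{poly}(|V|,|E|))$: for every real $c$ and every polynomial $p$ in two variables with coefficients in $\mathbb{N}$ there is a polynomial $q$ in two variables with coefficients in $\mathbb{N}$ such that for every signed hypergraph $H=(V,S)$ with underlying hypergraph $G=(V,E)$ and every $k\in\mathbb{N}$ with $\mathrm{nsw}(G)\le k\le c\log p(|V|,|E|)$ (where $\log 0:=0$), $\mathrm{PBP}(H)$ has an extended formulation with at most $q(|V|,|S|)$ variables and at most $q(|V|,|S|)$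 inequalities, in which all coefficients and right-hand side constants are $0,\pm1$. -/

import Mathlib

universe u

/-- A finite hypergraph with nodes in `α`: a finite set of nodes and a set of edges, each of which
is a subset of the node set of cardinality at least two. -/
structure FiniteHypergraph (α : Type u) where
  nodes : Finset α
  edges : Finset (Finset α)
  subset_nodes : ∀ e ∈ edges, e ⊆ nodes
  two_le_card : ∀ e ∈ edges, 2 ≤ e.card

namespace FiniteHypergraph

variable {α : Type u}

/-- The rank: the maximum cardinality of an edge. -/
def rank (G : FiniteHypergraph α) : ℕ := G.edges.sup Finset.card

variable [DecidableEq α]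

/-- `G - N`: the nodes in `N` are removed from the node set and from all edges, and only those
remaining edges that still have at least two nodes are kept. -/
def delete (G : FiniteHypergraph α) (N : Finset α) : FiniteHypergraph α where
  nodes := G.nodes \ N
  edges := (G.edges.image (fun e => e \ N)).filter (fun e => 2 ≤ e.card)
  subset_nodes := by
    intro e he
    obtain ⟨f, hf, rfl⟩ := Finset.mem_image.mp (Finset.mem_filter.mp he).1
    exact Finset.sdiff_subset_sdiff (G.subset_nodes f hf) (Finset.Subset.refl N)
  two_le_card := fun _ he => (Finset.mem_filter.mp he).2

/-- `N` is a nest-set of `G`: it is a set of nodes and `{e \ N : e ∈ E, e ∩ N ≠ ∅}` is totally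
ordered by inclusion. -/
def IsNestSet (G : FiniteHypergraph α) (N : Finset α) : Prop :=
  N ⊆ G.nodes ∧
    IsChain (fun a b : Finset α => a ⊆ b) {f | ∃ e ∈ G.edges, (e ∩ N).Nonempty ∧ f = e \ N}

/-- `N₁` is a nest-set of `G`, `N₂` is a nest-set of `G - N₁`, `N₃` is a nest-set of
`G - N₁ - N₂`, and so on. -/
def IsNestSetSequence : FiniteHypergraph α → List (Finset α) → Prop
  | _, [] => True
  | G, N :: L => G.IsNestSet N ∧ IsNestSetSequence (G.delete N) L

/-- A nest-set elimination order of `G`. -/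
structure IsNestSetEliminationOrder (G : FiniteHypergraph α) (L : List (Finset α)) : Prop where
  pairwise_disjoint : L.Pairwise (fun M N => Disjoint M N)
  cover : ∀ v, v ∈ G.nodes ↔ ∃ N ∈ L, v ∈ N
  isNestSetSequence : G.IsNestSetSequence L

/-- The nest-set width of an elimination order: the maximum cardinality of its members. -/
def orderWidth (L : List (Finset α)) : ℕ := (L.map Finset.card).foldr max 0

/-- The nest-set width `nsw(G)`: the minimum width of a nest-set elimination order of `G`. -/
noncomputable def nestSetWidth (G : FiniteHypergraph α) : ℕ :=
  sInf {w | ∃ L : List (Finset α), G.IsNestSetEliminationOrder L ∧ orderWidth L = w}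

/-- Every hypergraph has a nest-set elimination order, so the infimum above is a minimum. -/
theorem isNestSetEliminationOrder_singleton (G : FiniteHypergraph α) :
    G.IsNestSetEliminationOrder [G.nodes] where
  pairwise_disjoint := List.pairwise_singleton _ _
  cover := by simp
  isNestSetSequence := by
    refine ⟨⟨Finset.Subset.refl _, ?_⟩, trivial⟩
    rintro _ ⟨e, he, -, rfl⟩ _ ⟨f, hf, -, rfl⟩ -
    left
    rw [Finset.sdiff_eq_empty_iff_subset.mpr (G.subset_nodes e he)]
    exact Finset.empty_subset _

end FiniteHypergraph

/-- A signed edge on `V`: a set of at least two nodes with a sign `+1` or `-1` for each of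
them. -/
structure SignedEdge (V : Type u) where
  carrier : Finset V
  two_le_card : 2 ≤ carrier.card
  sign : carrier → ℤˣ

/-- A signed hypergraph whose node set is the (finite) type `V`. Parallel signed edges are allowed,
identical ones are not, as the signed edges form a set. -/
structure SignedHypergraph (V : Type u) where
  edges : Finset (SignedEdge V)

namespace SignedHypergraph

variable {V : Type u} [Fintype V]

/-- The underlying hypergraph: signs are ignored and parallel edges are merged. -/
def underlying [DecidableEq V] (H : SignedHypergraph V) : FiniteHypergraph V where
  nodes := Finset.univ
  edges := H.edges.image SignedEdge.carrier
  subset_nodes := fun _ _ => Finset.subset_univ _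
  two_le_card := by
    intro e he
    obtain ⟨s, -, rfl⟩ := Finset.mem_image.mp he
    exact s.two_le_card

/-- The rank of a signed hypergraph is the rank of its underlying hypergraph. -/
def rank [DecidableEq V] (H : SignedHypergraph V) : ℕ := H.underlying.rank

/-- The pseudo-Boolean set of `H`, in the space with one coordinate for every node and one for every
signed edge: the 0/1 points with `z_s = ∏_{v ∈ s} σ_s(z_v)`, where `σ_s(z_v)` is `z_v` if `v` has
sign `+1` in `s`, and `1 - z_v` if it has sign `-1`. -/
def pseudoBooleanSet (H : SignedHypergraph V) : Set (V ⊕ H.edges → ℝ) :=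
  {z | (∀ i, z i = 0 ∨ z i = 1) ∧
    ∀ s : H.edges, z (Sum.inr s) =
      ∏ v : s.1.carrier,
        if s.1.sign v = 1 then z (Sum.inl v.1) else 1 - z (Sum.inl v.1)}

/-- The pseudo-Boolean polytope of `H`. -/
def pseudoBooleanPolytope (H : SignedHypergraph V) : Set (V ⊕ H.edges → ℝ) :=
  convexHull ℝ H.pseudoBooleanSet

end SignedHypergraph

/-- An extended formulation of a set `P ⊆ ℝ^ι`: a finite system of linear inequalities
`A x + B y ≤ b` in the variables `x ∈ ℝ^ι` and finitely many additional variables `y`, such that `P`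
is the projection of the solution set to the `x`-space. (An equation is written as two
inequalities.) -/
structure ExtendedFormulation {ι : Type u} [Fintype ι] (P : Set (ι → ℝ)) where
  numAdditional : ℕ
  numInequalities : ℕ
  A : Matrix (Fin numInequalities) ι ℝ
  B : Matrix (Fin numInequalities) (Fin numAdditional) ℝ
  b : Fin numInequalities → ℝ
  projection_eq : {x : ι → ℝ | ∃ y : Fin numAdditional → ℝ,
    ∀ i, (A.mulVec x) i + (B.mulVec y) i ≤ b i} = P

namespace ExtendedFormulation

variable {ι : Type u} [Fintype ι] {P : Set (ι → ℝ)}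

/-- The number of all variables: original and additional ones. -/
def numVariables (F : ExtendedFormulation P) : ℕ := Fintype.card ι + F.numAdditional

/-- All coefficients and right-hand side constants are `0`, `1` or `-1`. -/
def HasUnitCoefficients (F : ExtendedFormulation P) : Prop :=
  (∀ i j, F.A i j = 0 ∨ F.A i j = 1 ∨ F.A i j = -1) ∧
  (∀ i j, F.B i j = 0 ∨ F.B i j = 1 ∨ F.B i j = -1) ∧
  (∀ i, F.b i = 0 ∨ F.b i = 1 ∨ F.b i = -1)

end ExtendedFormulation

/-! A point of the polytope records a random 0/1 assignment of the nodes: its node coordinates are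
expectations, and its edge coordinates are the probabilities that the assignment agrees with the
literals of the signed edges (`pseudoBooleanPolytope_eq`). The nodes are eliminated along a nest-set
order, while the family of partial assignments keeps its index set and its members shrink.

To eliminate a nest-set `N`, take the partial assignments that meet `N` and restrict each to the
complement of `N`. The domains of these traces form a chain, so the traces with which an assignment
`x` agrees are exactly those below a largest one, `t x` (`exists_agrees_iff_le`). All that these
edges see of `x` outside `N` is thus `t x`, which takes at most `|S| + 1` values. It suffices to add
the joint distribution `l` of `t x` and the values on `N`, that is `(|S| + 1) 2^|N|` variables.

Conversely, let `l` and a distribution `p` for the smaller problem give the same probability of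
agreement with each trace. These probabilities are the sums over principal up-sets, so `l` and `p`
induce the same law of `t x` (`eq_of_sum_ge_eq`). They can then be glued by making `x` and the
values on `N` conditionally independent given `t x` (`exists_coupling`). This gives
`mem_agreementPolytope_union_iff`, a linear description of one elimination step. Since the members
of the order have total size at most `|V|`, summing the costs gives the bound. -/

open Finset

/-- `P` is the projection of the solution set of a system of at most `n` linear inequalities with
coefficients and constants in `{0, 1, -1}` and at most `m` additional variables. -/
def HasUnitFormulation {ι : Type u} [Fintype ι] (P : Set (ι → ℝ)) (m n : ℕ) : Prop :=
  ∃ (κ ρ : Type u) (_ : Fintype κ) (_ : Fintype ρ) (A : ρ → ι → ℝ) (B : ρ → κ → ℝ) (b : ρ → ℝ),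
    Fintype.card κ ≤ m ∧ Fintype.card ρ ≤ n ∧
    (∀ i j, A i j = 0 ∨ A i j = 1 ∨ A i j = -1) ∧
    (∀ i j, B i j = 0 ∨ B i j = 1 ∨ B i j = -1) ∧
    (∀ i, b i = 0 ∨ b i = 1 ∨ b i = -1) ∧
    ∀ x, x ∈ P ↔ ∃ y : κ → ℝ, ∀ i, ∑ j, A i j * x j + ∑ j, B i j * y j ≤ b i

/-! ### Operations on unit-coefficient formulations -/

namespace HasUnitFormulation

variable {ι κ ρ : Type u} [Fintype ι] [Fintype κ] [Fintype ρ]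

theorem mono {P : Set (ι → ℝ)} {m n m' n' : ℕ} (h : HasUnitFormulation P m n) (hm : m ≤ m')
    (hn : n ≤ n') : HasUnitFormulation P m' n' := by
  obtain ⟨κ, ρ, i1, i2, A, B, b, h1, h2, h3⟩ := h
  exact ⟨κ, ρ, i1, i2, A, B, b, h1.trans hm, h2.trans hn, h3⟩

theorem of_system (A : ρ → ι → ℝ) (b : ρ → ℝ)
    (hA : ∀ i j, A i j = 0 ∨ A i j = 1 ∨ A i j = -1) (hb : ∀ i, b i = 0 ∨ b i = 1 ∨ b i = -1) :
    HasUnitFormulation {x | ∀ i, ∑ j, A i j * x j ≤ b i} 0 (Fintype.card ρ) := by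
  refine ⟨PEmpty, ρ, inferInstance, inferInstance, A, fun _ _ => 0, b, by simp, le_rfl, hA,
    by simp, hb, fun x => ?_⟩
  simp

theorem inter {P P' : Set (ι → ℝ)} {m n m' n' : ℕ} (h : HasUnitFormulation P m n)
    (h' : HasUnitFormulation P' m' n') : HasUnitFormulation (P ∩ P') (m + m') (n + n') := by
  obtain ⟨κ, ρ, i1, i2, A, B, b, h1, h2, hA, hB, hb, hP⟩ := h
  obtain ⟨κ', ρ', i1', i2', A', B', b', h1', h2', hA', hB', hb', hP'⟩ := h'
  refine ⟨κ ⊕ κ', ρ ⊕ ρ', inferInstance, inferInstance, Sum.elim A A',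
    Sum.elim (fun i => Sum.elim (B i) 0) (fun i => Sum.elim 0 (B' i)), Sum.elim b b',
    by simp only [Fintype.card_sum]; omega, by simp only [Fintype.card_sum]; omega,
    ?_, ?_, ?_, fun x => ?_⟩
  · rintro (i | i) j
    exacts [hA i j, hA' i j]
  · rintro (i | i) (j | j)
    · exact hB i j
    · exact Or.inl rfl
    · exact Or.inl rfl
    · exact hB' i j
  · rintro (i | i)
    exacts [hb i, hb' i]
  · rw [Set.mem_inter_iff, hP, hP']
    constructor
    · rintro ⟨⟨y, hy⟩, y', hy'⟩
      refine ⟨Sum.elim y y', ?_⟩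
      rintro (i | i)
      · simpa using hy i
      · simpa using hy' i
    · rintro ⟨y, hy⟩
      refine ⟨⟨y ∘ Sum.inl, fun i => ?_⟩, y ∘ Sum.inr, fun i => ?_⟩
      · simpa using hy (Sum.inl i)
      · simpa using hy (Sum.inr i)

theorem project {P : Set (ι ⊕ κ → ℝ)} {m n : ℕ} (h : HasUnitFormulation P m n) :
    HasUnitFormulation {x : ι → ℝ | ∃ y : κ → ℝ, Sum.elim x y ∈ P} (m + Fintype.card κ) n := by
  obtain ⟨κ', ρ, i1, i2, A, B, b, h1, h2, hA, hB, hb, hP⟩ := h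
  refine ⟨κ ⊕ κ', ρ, inferInstance, i2, fun i j => A i (Sum.inl j),
    fun i => Sum.elim (fun j => A i (Sum.inr j)) (B i), b,
    by simp only [Fintype.card_sum]; omega, h2, fun i j => hA _ _, ?_, hb, fun x => ?_⟩
  · rintro i (j | j)
    exacts [hA _ _, hB _ _]
  · simp only [Set.mem_ofPred_eq, hP]
    constructor
    · rintro ⟨y, y', hy⟩
      refine ⟨Sum.elim y y', fun i => ?_⟩
      simpa [add_assoc] using hy i
    · rintro ⟨y, hy⟩
      refine ⟨y ∘ Sum.inl, y ∘ Sum.inr, fun i => ?_⟩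
      simpa [add_assoc] using hy i

theorem comap {P : Set (ι → ℝ)} {m n : ℕ} (h : HasUnitFormulation P m n) (f : ι → κ)
    (hf : Function.Injective f) : HasUnitFormulation {x : κ → ℝ | x ∘ f ∈ P} m n := by
  classical
  obtain ⟨κ', ρ, i1, i2, A, B, b, h1, h2, hA, hB, hb, hP⟩ := h
  refine ⟨κ', ρ, i1, i2, fun i => Function.extend f (A i) 0, B, b, h1, h2, fun i j => ?_, hB, hb,
    fun x => ?_⟩
  · by_cases hj : ∃ j', f j' = j
    · obtain ⟨j', rfl⟩ := hj
      simpa only [hf.extend_apply] using hA i j'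
    · exact Or.inl (Function.extend_apply' _ _ _ hj)
  · have key : ∀ i, ∑ j, Function.extend f (A i) 0 j * x j = ∑ j, A i j * (x ∘ f) j := by
      intro i
      refine (Fintype.sum_of_injective f hf _ _ (fun j hj => ?_) (fun j => ?_)).symm
      · rw [Function.extend_apply' _ _ _ (fun ⟨a, ha⟩ => hj ⟨a, ha⟩)]
        simp
      · rw [hf.extend_apply]
        rfl
    simp only [Set.mem_ofPred_eq, hP, key]

theorem nonneg (f : ρ → ι) :
    HasUnitFormulation {x : ι → ℝ | ∀ i, 0 ≤ x (f i)} 0 (Fintype.card ρ) := by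
  classical
  have := of_system (fun (i : ρ) (j : ι) => if j = f i then (-1 : ℝ) else 0) (fun _ => 0)
    (fun i j => by split_ifs <;> simp) (fun _ => Or.inl rfl)
  simpa using this

theorem of_equations (A : ρ → ι → ℝ) (b : ρ → ℝ)
    (hA : ∀ i j, A i j = 0 ∨ A i j = 1 ∨ A i j = -1) (hb : ∀ i, b i = 0 ∨ b i = 1 ∨ b i = -1) :
    HasUnitFormulation {x | ∀ i, ∑ j, A i j * x j = b i} 0 (2 * Fintype.card ρ) := by
  have neg : ∀ c : ℝ, c = 0 ∨ c = 1 ∨ c = -1 → -c = 0 ∨ -c = 1 ∨ -c = -1 := by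
    rintro c (rfl | rfl | rfl) <;> simp
  have := (of_system A b hA hb).inter
    (of_system (fun i j => -A i j) (fun i => -b i) (fun i j => neg _ (hA i j)) fun i => neg _ (hb i))
  rw [two_mul]
  convert this using 1
  ext x
  simp only [Set.mem_ofPred_eq, Set.mem_inter_iff, neg_mul, sum_neg_distrib, neg_le_neg_iff,
    ← forall_and, ← le_antisymm_iff]

theorem coord_eq_sum [DecidableEq ι] (f : ρ → ι) (J : ρ → Finset ι) (hJ : ∀ i, f i ∉ J i) :
    HasUnitFormulation {x : ι → ℝ | ∀ i, x (f i) = ∑ j ∈ J i, x j} 0 (2 * Fintype.card ρ) := by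
  have := of_equations
    (fun (i : ρ) (j : ι) => (if j ∈ J i then (1 : ℝ) else 0) - if j = f i then (1 : ℝ) else 0)
    (fun _ => 0) (fun i j => by
      by_cases h : j = f i
      · subst h
        simp [hJ i]
      · simp only [h, if_false, sub_zero]
        split_ifs <;> simp) (fun _ => Or.inl rfl)
  convert this using 1
  ext x
  refine forall_congr' fun i => ?_
  simp [sub_mul, sub_eq_zero, eq_comm]

theorem sum_eq_one [DecidableEq ι] (J : Finset ι) :
    HasUnitFormulation {x : ι → ℝ | ∑ j ∈ J, x j = 1} 0 2 := by
  have := of_equations (fun (_ : PUnit.{u + 1}) (j : ι) => if j ∈ J then (1 : ℝ) else 0)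
    (fun _ => 1) (fun i j => by split_ifs <;> simp) (fun _ => by simp)
  simpa using this

theorem exists_extendedFormulation {P : Set (ι → ℝ)} {m n : ℕ} (h : HasUnitFormulation P m n) :
    ∃ F : ExtendedFormulation P, F.numVariables ≤ Fintype.card ι + m ∧ F.numInequalities ≤ n ∧
      F.HasUnitCoefficients := by
  obtain ⟨κ, ρ, i1, i2, A, B, b, h1, h2, hA, hB, hb, hP⟩ := h
  let e := (Fintype.equivFin κ).symm
  let d := (Fintype.equivFin ρ).symm
  refine ⟨⟨Fintype.card κ, Fintype.card ρ, fun i j => A (d i) j, fun i j => B (d i) (e j),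
    fun i => b (d i), ?_⟩, Nat.add_le_add_left h1 _, h2,
    fun i j => hA _ _, fun i j => hB _ _, fun i => hb _⟩
  ext x
  simp only [Set.mem_ofPred_eq, hP, Matrix.mulVec, dotProduct]
  rw [(e.arrowCongr (Equiv.refl ℝ)).exists_congr_left]
  refine exists_congr fun y => ?_
  rw [← d.forall_congr_right]
  refine forall_congr' fun i => ?_
  rw [← e.sum_comp]
  simp

end HasUnitFormulation

/-! ### Gluing distributions and inverting up-set sums -/

/-- Weights on a product with prescribed marginals: `p` on `X`, and `l` on the image of `X × A`
under `(x, a) ↦ (t x, a)`. -/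
theorem exists_coupling {X T A : Type*} [Fintype X] [Fintype T] [Fintype A] [DecidableEq T]
    (t : X → T) (p : X → ℝ) (l : T × A → ℝ) (hp : ∀ x, 0 ≤ p x) (hl : ∀ i, 0 ≤ l i)
    (h : ∀ τ, ∑ a, l (τ, a) = ∑ x with t x = τ, p x) :
    ∃ r : X × A → ℝ, (∀ i, 0 ≤ r i) ∧ (∀ x, ∑ a, r (x, a) = p x) ∧
      ∀ τ a, ∑ x with t x = τ, r (x, a) = l (τ, a) := by
  -- Conditional independence given `t x`. If the denominator is zero, the quotient is 0 by
  -- convention; this is harmless, since `p` and `l` then vanish on the whole fibre.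
  refine ⟨fun i => p i.1 * l (t i.1, i.2) / ∑ a, l (t i.1, a),
    fun i => div_nonneg (mul_nonneg (hp _) (hl _)) (sum_nonneg fun a _ => hl _),
    fun x => ?_, fun τ a => ?_⟩
  · simp only
    rw [← sum_div, ← mul_sum]
    by_cases h0 : ∑ a, l (t x, a) = 0
    · have h1 := h (t x)
      rw [h0, eq_comm, sum_eq_zero_iff_of_nonneg fun x _ => hp x] at h1
      rw [h1 x (by simp), zero_mul, zero_div]
    · exact mul_div_cancel_right₀ _ h0
  · have : ∀ x ∈ univ.filter (fun x => t x = τ),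
        p x * l (t x, a) / ∑ a, l (t x, a) = p x * (l (τ, a) / ∑ a, l (τ, a)) := by
      intro x hx
      rw [(mem_filter.mp hx).2, mul_div_assoc]
    simp only
    rw [sum_congr rfl this, ← sum_mul, ← h]
    by_cases h0 : ∑ a, l (τ, a) = 0
    · rw [h0, zero_mul]
      rw [sum_eq_zero_iff_of_nonneg fun a _ => hl _] at h0
      rw [h0 a (mem_univ _)]
    · exact mul_div_cancel₀ _ h0

/-- Functions on a finite partial order with the same sums over all principal up-sets are equal. -/
theorem eq_of_sum_ge_eq {T : Type*} [Fintype T] [PartialOrder T] [DecidableLE T] (f g : T → ℝ)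
    (h : ∀ τ, ∑ t with τ ≤ t, f t = ∑ t with τ ≤ t, g t) : f = g := by
  classical
  funext τ
  -- Downward induction: the values strictly above `τ` already coincide and cancel.
  induction τ using WellFoundedGT.induction with
  | ind τ ih =>
    have key : ∀ f : T → ℝ, ∑ t with τ ≤ t, f t = f τ + ∑ t with τ < t, f t := by
      intro f
      rw [← add_sum_erase _ _ (show τ ∈ univ.filter (τ ≤ ·) by simp)]
      congr 1
      refine sum_congr ?_ fun _ _ => rfl
      ext t
      simp [lt_iff_le_and_ne, and_comm, eq_comm]
    have := h τ
    rw [key, key, sum_congr rfl fun t ht => ih t (mem_filter.mp ht).2] at this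
    exact add_right_cancel this

/-! ### Agreement probabilities of random assignments -/

/-- The assignment `x` agrees with the partial assignment `τ`. -/
def Agrees {V : Type*} (τ : Finset (V × Bool)) (x : V → Bool) : Prop := ∀ i ∈ τ, x i.1 = i.2

/-- The points whose coordinates in `U` are the expectations of the bits of a random assignment, and
whose other coordinates are the probabilities that it agrees with the given partial assignments. -/
def agreementPolytope {V S : Type*} [Fintype V] [DecidableEq V] (U : Set V)
    (π : S → Finset (V × Bool)) : Set (V ⊕ S → ℝ) :=
  open Classical in
  {z | ∃ p : (V → Bool) → ℝ, (∀ x, 0 ≤ p x) ∧ ∑ x, p x = 1 ∧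
    (∀ v ∈ U, z (Sum.inl v) = ∑ x with x v = true, p x) ∧
    ∀ s, z (Sum.inr s) = ∑ x with Agrees (π s) x, p x}

-- The pushforward of `r` along `f` is the required distribution on assignments.
open Classical in
theorem mem_agreementPolytope_of_weights {V S Ω : Type*} [Fintype V] [DecidableEq V] [Fintype Ω]
    {U : Set V} {π : S → Finset (V × Bool)} {z : V ⊕ S → ℝ} (f : Ω → V → Bool) (r : Ω → ℝ)
    (hr : ∀ i, 0 ≤ r i) (h1 : ∑ i, r i = 1)
    (hU : ∀ v ∈ U, z (Sum.inl v) = ∑ i with f i v = true, r i)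
    (hS : ∀ s, z (Sum.inr s) = ∑ i with Agrees (π s) (f i), r i) :
    z ∈ agreementPolytope U π := by
  have key : ∀ P : (V → Bool) → Prop,
      ∑ x with P x, ∑ i with f i = x, r i = ∑ i with P (f i), r i := by
    intro P
    simp only [sum_filter]
    rw [← sum_filter, sum_comm]
    refine sum_congr rfl fun i _ => ?_
    simp
  refine ⟨fun x => ∑ i with f i = x, r i, fun x => sum_nonneg fun i _ => hr i, ?_, fun v hv => ?_,
    fun s => ?_⟩
  · simpa [h1] using key fun _ => True
  · rw [hU v hv]
    convert (key fun x => x v = true).symm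
  · rw [hS, key]

/-! ### Partial assignments with nested domains -/

section patterns

variable {V : Type*} [DecidableEq V]

/-- The partial assignment `τ` with the nodes in `N` unassigned. -/
def unassign (N : Finset V) (τ : Finset (V × Bool)) : Finset (V × Bool) := τ.filter (·.1 ∉ N)

theorem image_fst_unassign (N : Finset V) (τ : Finset (V × Bool)) :
    (unassign N τ).image Prod.fst = τ.image Prod.fst \ N := by
  ext v
  simp only [unassign, mem_image, mem_filter, mem_sdiff]
  aesop

/-- The assignment that is `a` on `N` and `x` elsewhere. -/
def overwrite (N : Finset V) (x : V → Bool) (a : N → Bool) (v : V) : Bool :=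
  if h : v ∈ N then a ⟨v, h⟩ else x v

/-- The assignment `a` of the nodes in `N` agrees with the partial assignment `τ`. -/
def AgreesOn (N : Finset V) (τ : Finset (V × Bool)) (a : N → Bool) : Prop :=
  ∀ i ∈ τ, ∀ h : i.1 ∈ N, a ⟨i.1, h⟩ = i.2

theorem agrees_overwrite {N : Finset V} {τ : Finset (V × Bool)} {x : V → Bool} {a : N → Bool} :
    Agrees τ (overwrite N x a) ↔ Agrees (unassign N τ) x ∧ AgreesOn N τ a := by
  simp only [Agrees, AgreesOn, unassign, mem_filter, overwrite]
  constructor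
  · refine fun h => ⟨fun i hi => ?_, fun i hi hN => ?_⟩
    · simpa [hi.2] using h i hi.1
    · simpa [hN] using h i hi
  · rintro ⟨h1, h2⟩ i hi
    split_ifs with hN
    exacts [h2 i hi hN, h1 i ⟨hi, hN⟩]

theorem overwrite_self (N : Finset V) (x : V → Bool) : overwrite N x (fun v => x v) = x := by
  funext v
  simp [overwrite]

/-- If the domains of finitely many partial assignments form a chain, then the ones with which an
assignment agrees are those below a maximal one. -/
theorem exists_agrees_iff_le (T : Finset (Finset (V × Bool))) (h0 : ∅ ∈ T)
    (hT : ∀ τ ∈ T, ∀ τ' ∈ T, τ.image Prod.fst ⊆ τ'.image Prod.fst ∨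
      τ'.image Prod.fst ⊆ τ.image Prod.fst) (x : V → Bool) :
    ∃ t : T, ∀ τ : T, Agrees τ.1 x ↔ τ ≤ t := by
  classical
  have hsub : ∀ {τ τ' : Finset (V × Bool)}, Agrees τ x → Agrees τ' x →
      τ.image Prod.fst ⊆ τ'.image Prod.fst → τ ⊆ τ' := by
    intro τ τ' h h' hs i hi
    obtain ⟨j, hj, hij⟩ := mem_image.mp (hs (mem_image_of_mem _ hi))
    have : j = i := Prod.ext hij (by rw [← h i hi, ← h' j hj, hij])
    exact this ▸ hj
  -- Two agreeing members are nested as soon as their domains are, so one of largest cardinality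
  -- contains all the others.
  obtain ⟨t, ht, hmax⟩ := exists_max_image (T.filter (Agrees · x)) card
    ⟨∅, mem_filter.mpr ⟨h0, by simp [Agrees]⟩⟩
  obtain ⟨htT, htx⟩ := mem_filter.mp ht
  refine ⟨⟨t, htT⟩, fun τ => ⟨fun h => ?_, fun h i hi => htx i (h hi)⟩⟩
  rcases hT τ τ.2 t htT with hs | hs
  · exact hsub h htx hs
  · exact (eq_of_subset_of_card_le (hsub htx h hs) (hmax τ (mem_filter.mpr ⟨τ.2, h⟩))).ge

end patterns

/-! ### Eliminating one nest-set -/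

section elimination

variable {V S : Type*} [DecidableEq V] [Fintype S]

/-- The partial assignment assigns some node in `N`. -/
def Meets (N : Finset V) (τ : Finset (V × Bool)) : Prop := ∃ i ∈ τ, i.1 ∈ N

theorem unassign_eq_self {N : Finset V} {τ : Finset (V × Bool)} (h : ¬Meets N τ) :
    unassign N τ = τ := by
  rw [unassign, filter_eq_self]
  exact fun i hi hN => h ⟨i, hi, hN⟩

open Classical in
/-- The partial assignments outside `N` that arise from those of the family that meet `N`, together
with the empty one. -/
noncomputable def traces (N : Finset V) (π : S → Finset (V × Bool)) :
    Finset (Finset (V × Bool)) :=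
  -- The empty trace ensures that every assignment agrees with some trace; its agreement probability
  -- is the total mass.
  insert ∅ ((univ.filter fun s => Meets N (π s)).image fun s => unassign N (π s))

theorem empty_mem_traces (N : Finset V) (π : S → Finset (V × Bool)) : ∅ ∈ traces N π :=
  mem_insert_self _ _

theorem unassign_mem_traces {N : Finset V} {π : S → Finset (V × Bool)} {s : S}
    (h : Meets N (π s)) : unassign N (π s) ∈ traces N π := by
  classical
  exact mem_insert_of_mem (mem_image_of_mem _ (by simpa using h))

theorem card_traces_le (N : Finset V) (π : S → Finset (V × Bool)) :
    (traces N π).card ≤ Fintype.card S + 1 := by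
  classical
  exact (card_insert_le _ _).trans (Nat.add_le_add_right (card_image_le.trans (card_le_univ _)) 1)

-- Here `w` holds the agreement probabilities after unassigning `N`, and `l` is the joint law of the
-- largest agreeing trace and the values on `N`. The equations for `w s` tie the law of that trace
-- to the smaller problem.
open Classical in
theorem mem_agreementPolytope_union_iff [Fintype V] {U : Set V} {N : Finset V}
    {π : S → Finset (V × Bool)}
    (hchain : ∀ τ ∈ traces N π, ∀ τ' ∈ traces N π,
      τ.image Prod.fst ⊆ τ'.image Prod.fst ∨ τ'.image Prod.fst ⊆ τ.image Prod.fst)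
    (z : V ⊕ S → ℝ) :
    z ∈ agreementPolytope (U ∪ N) π ↔
      ∃ (w : S → ℝ) (l : traces N π × (N → Bool) → ℝ),
        Sum.elim (fun v => z (Sum.inl v)) w ∈ agreementPolytope U (fun s => unassign N (π s)) ∧
        (∀ i, 0 ≤ l i) ∧ ∑ i, l i = 1 ∧
        (∀ v : N, z (Sum.inl v) = ∑ i with i.2 v = true, l i) ∧
        (∀ s : {s // Meets N (π s)}, w s = ∑ i with unassign N (π s) ⊆ i.1.1, l i) ∧
        ∀ s, z (Sum.inr s) = if Meets N (π s) then
          ∑ i with unassign N (π s) ⊆ i.1.1 ∧ AgreesOn N (π s) i.2, l i else w s := by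
  choose t ht using exists_agrees_iff_le (traces N π) (empty_mem_traces N π) hchain
  have hts : ∀ s x, Meets N (π s) →
      (Agrees (unassign N (π s)) x ↔ unassign N (π s) ⊆ (t x).1) := fun s x h =>
    ht x ⟨_, unassign_mem_traces h⟩
  constructor
  · rintro ⟨p, hp, hp1, hpU, hpS⟩
    let f : (V → Bool) → traces N π × (N → Bool) := fun x => (t x, fun v => x v)
    have key : ∀ P : traces N π × (N → Bool) → Prop,
        ∑ i with P i, ∑ x with f x = i, p x = ∑ x with P (f x), p x := by
      intro P
      simp only [sum_filter]
      rw [← sum_filter, sum_comm]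
      refine sum_congr rfl fun i _ => ?_
      simp
    refine ⟨fun s => ∑ x with Agrees (unassign N (π s)) x, p x,
      fun i => ∑ x with f x = i, p x, ⟨p, hp, hp1, fun v hv => ?_, fun s => rfl⟩,
      fun i => sum_nonneg fun x _ => hp x, ?_, fun v => ?_, fun s => ?_, fun s => ?_⟩
    · exact hpU v (Or.inl hv)
    · simpa [hp1] using key fun _ => True
    · rw [hpU v (Or.inr v.2)]
      convert (key fun i => i.2 v = true).symm
    · trans ∑ x with unassign N (π s) ⊆ (f x).1.1, p x
      · exact sum_congr (filter_congr fun x _ => hts s x s.2) fun _ _ => rfl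
      · convert (key fun i => unassign N (π s) ⊆ i.1.1).symm
    · rw [hpS]
      split_ifs with h
      · trans ∑ x with unassign N (π s) ⊆ (f x).1.1 ∧ AgreesOn N (π s) (f x).2, p x
        · refine sum_congr (filter_congr fun x _ => ?_) fun _ _ => rfl
          conv_lhs => rw [← overwrite_self N x]
          rw [agrees_overwrite, hts s x h]
        · convert (key fun i => unassign N (π s) ⊆ i.1.1 ∧ AgreesOn N (π s) i.2).symm
      · simp only [unassign_eq_self h]
  · rintro ⟨w, l, ⟨p, hp, hp1, hpU, hpS⟩, hl, hl1, hlN, hw, hz⟩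
    -- Both sides are compared through their sums over principal up-sets. At `∅` these are the total
    -- mass 1; at any other trace they are a coordinate of `w`, computed once from `l` and once from
    -- `p`.
    have hmarg : ∀ τ, ∑ a, l (τ, a) = ∑ x with t x = τ, p x := by
      refine fun τ => congrFun (eq_of_sum_ge_eq (fun τ => ∑ a, l (τ, a))
        (fun τ => ∑ x with t x = τ, p x) fun τ => ?_) τ
      have h1 : ∑ t' with τ ≤ t', ∑ a, l (t', a) = ∑ i with τ ≤ i.1, l i := by
        simp only [sum_filter, Fintype.sum_prod_type]
        exact sum_congr rfl fun _ _ => by split_ifs <;> simp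
      have h2 : ∑ t' with τ ≤ t', ∑ x with t x = t', p x = ∑ x with τ ≤ t x, p x := by
        simp only [sum_filter]
        rw [← sum_filter, sum_comm]
        exact sum_congr rfl fun _ _ => by simp
      rw [h1, h2]
      rcases mem_insert.mp τ.2 with h0 | h0
      · have h3 : ∀ τ' : traces N π, τ ≤ τ' := fun τ' => by
          rw [← Subtype.coe_le_coe, h0]
          exact empty_subset _
        simp [h3, hl1, hp1]
      · obtain ⟨s, hs, hsτ⟩ := mem_image.mp h0
        have hs := (mem_filter.mp hs).2
        have h4 := (hw ⟨s, hs⟩).symm.trans (hpS s)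
        simp only [hsτ, ht _ τ] at h4
        exact h4
    obtain ⟨r, hr, hrp, hrl⟩ := exists_coupling t p l hp hl hmarg
    have keyp : ∀ P : (V → Bool) → Prop, ∑ i with P i.1, r i = ∑ x with P x, p x := by
      intro P
      simp only [sum_filter, Fintype.sum_prod_type]
      exact sum_congr rfl fun x _ => by split_ifs <;> simp [hrp]
    have keyl : ∀ P : traces N π × (N → Bool) → Prop,
        ∑ i with P (t i.1, i.2), r i = ∑ i with P i, l i := by
      intro P
      simp only [sum_filter, Fintype.sum_prod_type]
      rw [sum_comm, sum_comm (s := (univ : Finset (traces N π)))]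
      refine sum_congr rfl fun a _ => ?_
      rw [← sum_fiberwise _ t]
      refine sum_congr rfl fun τ _ => ?_
      rw [← hrl τ a]
      by_cases h : P (τ, a)
      · rw [if_pos h]
        refine sum_congr rfl fun x hx => ?_
        rw [(mem_filter.mp hx).2, if_pos h]
      · rw [if_neg h]
        refine sum_eq_zero fun x hx => ?_
        rw [(mem_filter.mp hx).2, if_neg h]
    -- The glued assignment takes its values on `N` from the second component and the rest from the
    -- first.
    refine mem_agreementPolytope_of_weights (fun i => overwrite N i.1 i.2) r hr ?_ ?_ fun s => ?_
    · simpa [hp1] using keyp fun _ => True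
    · intro v hv
      by_cases hN : v ∈ N
      · simp only [overwrite, hN, dif_pos]
        rw [hlN ⟨v, hN⟩]
        convert (keyl fun i => i.2 ⟨v, hN⟩ = true).symm
      · simp only [overwrite, hN, dif_neg, not_false_eq_true]
        have := hpU v (hv.resolve_right (by simpa using hN))
        simp only [Sum.elim_inl] at this
        rw [this]
        convert (keyp fun x => x v = true).symm
    · rw [hz]
      simp only [agrees_overwrite]
      split_ifs with h
      · simp only [hts s _ h]
        convert (keyl fun i => unassign N (π s) ⊆ i.1.1 ∧ AgreesOn N (π s) i.2).symm
      · have h1 : ∀ a, AgreesOn N (π s) a := fun a i hi hN => (h ⟨i, hi, hN⟩).elim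
        simp only [h1, and_true]
        rw [keyp]
        exact hpS s

end elimination

/-- The new variables are `w` and `l`. The new inequalities are the signs of `l`, and two for each
equation: the normalisation, one per node of `N`, and at most two per index in `S`. -/
theorem HasUnitFormulation.agreementPolytope_union {V S : Type u} [DecidableEq V] [Fintype S]
    [Fintype V] {U : Set V} {N : Finset V} {π : S → Finset (V × Bool)} {m n : ℕ}
    (hchain : ∀ τ ∈ traces N π, ∀ τ' ∈ traces N π,
      τ.image Prod.fst ⊆ τ'.image Prod.fst ∨ τ'.image Prod.fst ⊆ τ.image Prod.fst)
    (h : HasUnitFormulation (agreementPolytope U (fun s => unassign N (π s))) m n) :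
    HasUnitFormulation (agreementPolytope (U ∪ N) π)
      (m + (Fintype.card S + (Fintype.card S + 1) * 2 ^ N.card))
      (n + ((Fintype.card S + 1) * 2 ^ N.card + 2 + 2 * N.card + 4 * Fintype.card S)) := by
  classical
  let lam : traces N π × (N → Bool) ↪ (V ⊕ S) ⊕ (S ⊕ (traces N π × (N → Bool))) :=
    ⟨fun i => Sum.inr (Sum.inr i), fun i j hij => Sum.inr_injective (Sum.inr_injective hij)⟩
  -- The smaller polytope uses the old node coordinates but the new edge coordinates `w`.
  let f : V ⊕ S → (V ⊕ S) ⊕ (S ⊕ (traces N π × (N → Bool))) := Sum.elim (fun v => Sum.inl (Sum.inl v)) fun s =>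
    Sum.inr (Sum.inl s)
  have hlam : ∀ i, lam i = Sum.inr (Sum.inr i) := fun _ => rfl
  have hf : Function.Injective f := by
    rintro (v | s) (v' | s') h <;> simp_all [f]
  have key := ((((((h.comap f hf).inter (HasUnitFormulation.nonneg lam)).inter
    (HasUnitFormulation.sum_eq_one (univ.map lam))).inter
    (HasUnitFormulation.coord_eq_sum (fun v : N => (Sum.inl (Sum.inl v.1) : (V ⊕ S) ⊕ (S ⊕ (traces N π × (N → Bool)))))
      (fun v => (univ.filter fun i => i.2 v = true).map lam) (by simp [hlam]))).inter
    (HasUnitFormulation.coord_eq_sum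
      (fun s : {s // Meets N (π s)} => (Sum.inr (Sum.inl s.1) : (V ⊕ S) ⊕ (S ⊕ (traces N π × (N → Bool)))))
      (fun s => (univ.filter fun i => unassign N (π s) ⊆ i.1.1).map lam) (by simp [hlam]))).inter
    (HasUnitFormulation.coord_eq_sum
      (fun s : S => (Sum.inl (Sum.inr s) : (V ⊕ S) ⊕ (S ⊕ (traces N π × (N → Bool)))))
      (fun s => if Meets N (π s) then
        (univ.filter fun i => unassign N (π s) ⊆ i.1.1 ∧ AgreesOn N (π s) i.2).map lam
        else {Sum.inr (Sum.inl s)}) (by intro s; split_ifs <;> simp [hlam]))).project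
  have hκ : Fintype.card (traces N π × (N → Bool)) ≤ (Fintype.card S + 1) * 2 ^ N.card := by
    simpa using Nat.mul_le_mul_right (2 ^ N.card) (card_traces_le N π)
  have hs : Fintype.card {s // Meets N (π s)} ≤ Fintype.card S := Fintype.card_subtype_le _
  have hN : Fintype.card N = N.card := Fintype.card_coe N
  have key' := key.mono
    (m' := m + (Fintype.card S + (Fintype.card S + 1) * 2 ^ N.card))
    (n' := n + ((Fintype.card S + 1) * 2 ^ N.card + 2 + 2 * N.card + 4 * Fintype.card S))
    (by simp only [Fintype.card_sum]; omega) (by omega)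
  convert key' using 1
  ext z
  rw [mem_agreementPolytope_union_iff hchain]
  constructor
  · rintro ⟨w, l, h1, h2, h3, h4, h5, h6⟩
    refine ⟨Sum.elim w l, ⟨⟨⟨⟨⟨?_, h2⟩, ?_⟩, ?_⟩, ?_⟩, ?_⟩⟩
    · rw [Set.mem_ofPred_eq]
      convert h1 using 1
      ext (v | s) <;> rfl
    · simpa [hlam] using h3
    · intro v
      simpa [hlam] using h4 v
    · intro s
      simpa [hlam] using h5 s
    · intro s
      have := h6 s
      split_ifs at this ⊢ with hm <;> simpa [hlam, hm] using this
  · rintro ⟨y, ⟨⟨⟨⟨⟨h1, h2⟩, h3⟩, h4⟩, h5⟩, h6⟩⟩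
    refine ⟨fun s => y (Sum.inl s), fun i => y (Sum.inr i), ?_, h2, ?_, fun v => ?_, fun s => ?_,
      fun s => ?_⟩
    · rw [Set.mem_ofPred_eq] at h1
      convert h1 using 1
      ext (v | s) <;> rfl
    · simpa [hlam] using h3
    · simpa [hlam] using h4 v
    · simpa [hlam] using h5 s
    · have := h6 s
      split_ifs at this ⊢ with hm <;> simpa [hlam, hm] using this

/-! ### Recursion along an elimination order -/

variable {V S : Type u} [DecidableEq V]

theorem unassign_empty (τ : Finset (V × Bool)) : unassign ∅ τ = τ := by simp [unassign]

/-- The traces on the complement of a nest-set have nested domains. -/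
theorem FiniteHypergraph.IsNestSet.traces_chain [Fintype S] {G : FiniteHypergraph V}
    {N : Finset V} (hN : G.IsNestSet N) {π : S → Finset (V × Bool)}
    (hG : ∀ s, 2 ≤ ((π s).image Prod.fst).card → (π s).image Prod.fst ∈ G.edges) :
    ∀ τ ∈ traces N π, ∀ τ' ∈ traces N π,
      τ.image Prod.fst ⊆ τ'.image Prod.fst ∨ τ'.image Prod.fst ⊆ τ.image Prod.fst := by
  classical
  have key : ∀ τ ∈ traces N π, τ.image Prod.fst = ∅ ∨
      τ.image Prod.fst ∈ {f | ∃ e ∈ G.edges, (e ∩ N).Nonempty ∧ f = e \ N} := by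
    intro τ hτ
    rcases mem_insert.mp hτ with rfl | h
    · exact Or.inl (image_empty _)
    obtain ⟨s, hs, rfl⟩ := mem_image.mp h
    obtain ⟨i, hi, hiN⟩ := (mem_filter.mp hs).2
    have hi' : i.1 ∈ (π s).image Prod.fst := mem_image_of_mem _ hi
    rw [image_fst_unassign]
    -- A domain with fewer than two nodes need not be an edge of `G`; but if it meets `N` it lies
    -- inside `N`, so its trace is empty.
    by_cases h2 : 2 ≤ ((π s).image Prod.fst).card
    · exact Or.inr ⟨_, hG s h2, ⟨i.1, mem_inter.mpr ⟨hi', hiN⟩⟩, rfl⟩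
    · left
      rw [sdiff_eq_empty_iff_subset]
      intro v hv
      rwa [card_le_one.mp (by omega) v hv i.1 hi']
  intro τ hτ τ' hτ'
  rcases key τ hτ with h | h
  · exact Or.inl (h ▸ empty_subset _)
  rcases key τ' hτ' with h' | h'
  · exact Or.inr (h' ▸ empty_subset _)
  exact hN.2.total h h'

theorem agreementPolytope_of_forall_eq_empty [Fintype V] {π : S → Finset (V × Bool)} (h : ∀ s, π s = ∅) :
    agreementPolytope (∅ : Set V) π = {z | ∀ s, z (Sum.inr s) = 1} := by
  classical
  ext z
  constructor
  · rintro ⟨p, -, hp1, -, hpS⟩ s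
    rw [hpS, ← hp1]
    simp [h, Agrees]
  · intro hz
    refine mem_agreementPolytope_of_weights (fun (_ : Unit) _ => true) (fun _ => 1)
      (fun _ => zero_le_one) (by simp) (by simp) fun s => ?_
    rw [hz s]
    simp [h, Agrees]

theorem step_bound {a k N : ℕ} (hN : 1 ≤ N) (hk : N ≤ k) :
    a + (a + 1) * 2 ^ N ≤ 10 * (a + 1) * 2 ^ k * N ∧
    (a + 1) * 2 ^ N + 2 + 2 * N + 4 * a ≤ 10 * (a + 1) * 2 ^ k * N := by
  have h1 : (a + 1) * 2 ^ N ≤ (a + 1) * 2 ^ k :=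
    Nat.mul_le_mul_left _ (Nat.pow_le_pow_right (by norm_num) hk)
  have h2 : a + 1 ≤ (a + 1) * 2 ^ k := Nat.le_mul_of_pos_right _ (by positivity)
  have h3 : (a + 1) * 2 ^ k ≤ (a + 1) * 2 ^ k * N := Nat.le_mul_of_pos_right _ hN
  have h4 : N ≤ (a + 1) * 2 ^ k * N := Nat.le_mul_of_pos_left _ (by positivity)
  have h5 : 10 * (a + 1) * 2 ^ k * N = 10 * ((a + 1) * 2 ^ k * N) := by ring
  rw [h5]
  omega

theorem hasUnitFormulation_agreementPolytope [Fintype S] [Fintype V] (k : ℕ) (L : List (Finset V)) :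
    ∀ (G : FiniteHypergraph V) (π : S → Finset (V × Bool)),
      G.IsNestSetSequence L → (∀ N ∈ L, N.card ≤ k) →
      (∀ s, 2 ≤ ((π s).image Prod.fst).card → (π s).image Prod.fst ∈ G.edges) →
      (∀ s, ∀ i ∈ π s, ∃ N ∈ L, i.1 ∈ N) →
      HasUnitFormulation (agreementPolytope {v | ∃ N ∈ L, v ∈ N} π)
        (10 * (Fintype.card S + 1) * 2 ^ k * (L.map card).sum)
        (2 * Fintype.card S + 10 * (Fintype.card S + 1) * 2 ^ k * (L.map card).sum) := by
  classical
  induction L with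
  | nil =>
    intro G π _ _ _ hcov
    -- No node is left, so all partial assignments are empty and always agreed with: every edge
    -- coordinate is 1.
    have h0 : ∀ s, π s = ∅ := fun s => eq_empty_of_forall_notMem fun i hi => by
      simpa using hcov s i hi
    have h1 := HasUnitFormulation.of_equations
      (fun (s : S) (j : V ⊕ S) => if j = Sum.inr s then (1 : ℝ) else 0) (fun _ => 1)
      (fun i j => by split_ifs <;> simp) (fun _ => by simp)
    have h2 : {v : V | ∃ N ∈ ([] : List (Finset V)), v ∈ N} = ∅ := by simp
    rw [h2, agreementPolytope_of_forall_eq_empty h0]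
    simpa using h1
  | cons N L ih =>
    intro G π hseq hk hG hcov
    obtain ⟨hN, hseq⟩ := hseq
    have hU : {v : V | ∃ M ∈ N :: L, v ∈ M} = {v | ∃ M ∈ L, v ∈ M} ∪ N := by
      ext v
      simp [or_comm]
    have hrec := ih (G.delete N) (fun s => unassign N (π s)) hseq
      (fun M hM => hk M (List.mem_cons_of_mem _ hM))
      (fun s hs => by
        rw [image_fst_unassign] at hs ⊢
        refine mem_filter.mpr ⟨mem_image_of_mem _ (hG s (hs.trans (card_le_card sdiff_subset))), hs⟩)
      (fun s i hi => by
        obtain ⟨hi, hiN⟩ := mem_filter.mp hi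
        obtain ⟨M, hM, hiM⟩ := hcov s i hi
        rcases List.mem_cons.mp hM with rfl | hM
        · exact (hiN hiM).elim
        · exact ⟨M, hM, hiM⟩)
    rw [hU, List.map_cons, List.sum_cons]
    -- The cost of a step is charged to `|N|`, so an empty member must cost nothing; removing it
    -- leaves the polytope unchanged.
    rcases N.eq_empty_or_nonempty with rfl | hne
    · simpa [unassign_empty] using hrec
    · obtain ⟨b1, b2⟩ := step_bound (a := Fintype.card S) hne.card_pos (hk N List.mem_cons_self)
      refine (hrec.agreementPolytope_union (hN.traces_chain hG)).mono ?_ ?_ <;>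
        rw [Nat.mul_add _ N.card] <;> omega

theorem FiniteHypergraph.IsNestSetSequence.sum_card_le {L : List (Finset V)} :
    ∀ {G : FiniteHypergraph V}, G.IsNestSetSequence L → (L.map card).sum ≤ G.nodes.card := by
  induction L with
  | nil => simp
  | cons N L ih =>
    rintro G ⟨hN, hL⟩
    have h1 : (L.map card).sum ≤ (G.nodes \ N).card := ih hL
    have h2 := card_sdiff_add_card_eq_card hN.1
    rw [List.map_cons, List.sum_cons]
    omega

theorem FiniteHypergraph.card_le_orderWidth {α : Type*} {L : List (Finset α)} {N : Finset α} (h : N ∈ L) :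
    N.card ≤ orderWidth L := by
  induction L with
  | nil => simp at h
  | cons M L ih =>
    rcases List.mem_cons.mp h with rfl | h
    · exact le_max_left _ _
    · exact (ih h).trans (le_max_right _ _)

theorem FiniteHypergraph.exists_order_orderWidth_eq (G : FiniteHypergraph V) :
    ∃ L, G.IsNestSetEliminationOrder L ∧ orderWidth L = G.nestSetWidth :=
  Nat.sInf_mem (s := {w | ∃ L : List (Finset V), G.IsNestSetEliminationOrder L ∧ orderWidth L = w})
    ⟨_, _, G.isNestSetEliminationOrder_singleton, rfl⟩

/-! ### The pseudo-Boolean polytope as an agreement polytope -/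

/-- The literals of a signed edge: its nodes with the values that they must take. -/
def SignedEdge.literals (s : SignedEdge V) : Finset (V × Bool) :=
  univ.image fun v : s.carrier => (v.1, decide (s.sign v = 1))

theorem SignedEdge.image_fst_literals (s : SignedEdge V) :
    s.literals.image Prod.fst = s.carrier := by
  ext v
  simp [SignedEdge.literals]

theorem SignedEdge.prod_eq_ite_agrees (s : SignedEdge V) (x : V → Bool)
    [Decidable (Agrees s.literals x)] :
    (∏ v : s.carrier, if s.sign v = 1 then (if x v.1 = true then (1 : ℝ) else 0)
      else 1 - if x v.1 = true then (1 : ℝ) else 0) = if Agrees s.literals x then 1 else 0 := by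
  have h : ∀ v : s.carrier, (if s.sign v = 1 then (if x v.1 = true then (1 : ℝ) else 0)
      else 1 - if x v.1 = true then (1 : ℝ) else 0) =
      if x v.1 = decide (s.sign v = 1) then 1 else 0 := by
    intro v
    by_cases h1 : s.sign v = 1 <;> cases h2 : x v.1 <;> simp [h1]
  simp only [h]
  have hiff : Agrees s.literals x ↔
      ∀ v ∈ (univ : Finset s.carrier), x v.1 = decide (s.sign v = 1) := by
    simp only [Agrees, SignedEdge.literals, forall_mem_image]
  by_cases hx : Agrees s.literals x
  · rw [if_pos hx]
    exact prod_eq_one fun v hv => if_pos (hiff.mp hx v hv)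
  · rw [if_neg hx]
    rw [hiff] at hx
    push Not at hx
    obtain ⟨v, hv, hne⟩ := hx
    exact prod_eq_zero hv (if_neg hne)

theorem convex_agreementPolytope {V S : Type*} [Fintype V] [DecidableEq V] (U : Set V)
    (π : S → Finset (V × Bool)) : Convex ℝ (agreementPolytope U π) := by
  rintro z ⟨p, hp, hp1, hpU, hpS⟩ z' ⟨p', hp', hp1', hpU', hpS'⟩ a b ha hb hab
  refine ⟨fun x => a * p x + b * p' x,
    fun x => add_nonneg (mul_nonneg ha (hp x)) (mul_nonneg hb (hp' x)), ?_, fun v hv => ?_,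
    fun s => ?_⟩
  · rw [sum_add_distrib, ← mul_sum, ← mul_sum, hp1, hp1', mul_one, mul_one, hab]
  · simp [sum_add_distrib, ← mul_sum, hpU v hv, hpU' v hv]
  · simp [sum_add_distrib, ← mul_sum, hpS, hpS']

/-- A pseudo-Boolean point comes from a point mass; conversely, the weights of a random assignment
are the coefficients of a convex combination of pseudo-Boolean points. -/
theorem SignedHypergraph.pseudoBooleanPolytope_eq [Fintype V] (H : SignedHypergraph V) :
    H.pseudoBooleanPolytope =
      agreementPolytope Set.univ (fun s : H.edges => s.1.literals) := by
  classical
  apply Set.Subset.antisymm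
  · refine convexHull_min ?_ (convex_agreementPolytope _ _)
    rintro z ⟨hz, hzs⟩
    have hx : ∀ v, z (Sum.inl v) = if decide (z (Sum.inl v) = 1) = true then (1 : ℝ) else 0 := by
      intro v
      rcases hz (Sum.inl v) with h | h <;> simp [h]
    refine mem_agreementPolytope_of_weights (fun (_ : Unit) v => decide (z (Sum.inl v) = 1))
      (fun _ => 1) (fun _ => zero_le_one) (by simp) (fun v _ => ?_) fun s => ?_
    · rw [sum_filter]
      simpa using hx v
    · rw [sum_filter, hzs, Fintype.sum_unique,
        ← SignedEdge.prod_eq_ite_agrees s.1 (fun v => decide (z (Sum.inl v) = 1))]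
      refine prod_congr rfl fun v _ => ?_
      rw [← hx]
  · rintro z ⟨p, hp, hp1, hpU, hpS⟩
    let q : (V → Bool) → V ⊕ H.edges → ℝ := fun x => Sum.elim (fun v => if x v = true then 1 else 0)
      fun s => if Agrees s.1.literals x then 1 else 0
    have hz : z = ∑ x, p x • q x := by
      ext (v | s)
      · rw [hpU v trivial, sum_filter]
        simp [q]
      · rw [hpS, sum_filter]
        simp [q]
    rw [hz]
    refine (convex_convexHull ℝ _).sum_mem (fun x _ => hp x) hp1 fun x _ =>
      subset_convexHull ℝ _ ⟨?_, fun s => ?_⟩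
    · rintro (v | s)
      · simp only [q, Sum.elim_inl]
        split_ifs <;> simp
      · simp only [q, Sum.elim_inr]
        split_ifs <;> simp
    · exact (SignedEdge.prod_eq_ite_agrees s.1 x).symm

/-- The pseudo-Boolean polytope has an extended formulation whose size is bounded in terms of the
nest-set width. -/
theorem SignedHypergraph.exists_extendedFormulation_of_nestSetWidth_le [Fintype V]
    (H : SignedHypergraph V) {k : ℕ} (hk : H.underlying.nestSetWidth ≤ k) :
    ∃ F : ExtendedFormulation H.pseudoBooleanPolytope,
      F.numVariables ≤ Fintype.card V + H.edges.card +
        10 * (H.edges.card + 1) * 2 ^ k * Fintype.card V ∧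
      F.numInequalities ≤ 2 * H.edges.card + 10 * (H.edges.card + 1) * 2 ^ k * Fintype.card V ∧
      F.HasUnitCoefficients := by
  classical
  obtain ⟨L, hL, hLw⟩ := H.underlying.exists_order_orderWidth_eq
  have hcov : ∀ v, ∃ N ∈ L, v ∈ N := fun v => (hL.cover v).mp (mem_univ v)
  have h := hasUnitFormulation_agreementPolytope (S := H.edges) k L H.underlying
    (fun s => s.1.literals) hL.isNestSetSequence
    (fun N hN => (FiniteHypergraph.card_le_orderWidth hN).trans (hLw.trans_le hk))
    (fun s _ => by
      rw [SignedEdge.image_fst_literals]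
      exact mem_image_of_mem _ s.2)
    (fun s i _ => hcov i.1)
  have hU : {v | ∃ N ∈ L, v ∈ N} = Set.univ := Set.eq_univ_of_forall hcov
  have hsum : (L.map card).sum ≤ Fintype.card V := hL.isNestSetSequence.sum_card_le
  rw [hU, ← H.pseudoBooleanPolytope_eq, Fintype.card_coe] at h
  obtain ⟨F, h1, h2, h3⟩ := h.exists_extendedFormulation
  have h4 := Nat.mul_le_mul_left (10 * (H.edges.card + 1) * 2 ^ k) hsum
  refine ⟨F, h1.trans ?_, h2.trans ?_, h3⟩
  · rw [Fintype.card_sum, Fintype.card_coe]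
    omega
  · omega

theorem SignedHypergraph.rank_pos [Fintype V] (H : SignedHypergraph V) (hS : H.edges.Nonempty) :
    1 ≤ H.rank := by
  obtain ⟨s, hs⟩ := hS
  have h : s.carrier.card ≤ H.rank :=
    le_sup (f := card) (mem_image_of_mem SignedEdge.carrier hs)
  exact le_trans (by norm_num) (s.two_le_card.trans h)

/-! ### Polynomial bounds and conclusion -/

theorem MvPolynomial.eval_mono_of_nat {σ : Type*} (p : MvPolynomial σ ℕ) {f g : σ → ℕ}
    (h : f ≤ g) : MvPolynomial.eval f p ≤ MvPolynomial.eval g p := by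
  rw [MvPolynomial.eval_eq, MvPolynomial.eval_eq]
  exact sum_le_sum fun d _ => Nat.mul_le_mul_left _
    (prod_le_prod' fun i _ => Nat.pow_le_pow_left (h i) _)

/-- A power of two with logarithmically bounded exponent is polynomially bounded. -/
theorem two_pow_le_of_le_mul_log {c : ℝ} {k P : ℕ} (h : (k : ℝ) ≤ c * Real.log P) :
    2 ^ k ≤ 1 + P ^ ⌈|c|⌉₊ := by
  -- For `P = 0` the convention `log 0 = 0` forces `k = 0`; the summand 1 in the bound covers this
  -- case.
  rcases Nat.eq_zero_or_pos P with rfl | hP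
  · simp only [Nat.cast_zero, Real.log_zero, mul_zero] at h
    have : k = 0 := by exact_mod_cast le_antisymm h (Nat.cast_nonneg k)
    subst this
    simp
  · have hlog : 0 ≤ Real.log P := Real.log_natCast_nonneg P
    have h1 : (k : ℝ) ≤ ⌈|c|⌉₊ * Real.log P :=
      h.trans (mul_le_mul_of_nonneg_right ((le_abs_self c).trans (Nat.le_ceil _)) hlog)
    have h2 : ((2 ^ k : ℕ) : ℝ) ≤ (P ^ ⌈|c|⌉₊ : ℕ) := by
      push_cast
      rw [← Real.log_le_log_iff (by positivity) (by positivity), Real.log_pow, Real.log_pow]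
      refine le_trans ?_ h1
      exact mul_le_of_le_one_right (Nat.cast_nonneg k)
        ((Real.log_two_lt_d9.le).trans (by norm_num))
    exact (Nat.cast_le.mp h2).trans (Nat.le_add_left _ _)

theorem mainTheorem5 :
    (∃ C : ℕ, ∀ (V : Type u) [Fintype V] [DecidableEq V] (H : SignedHypergraph V) (k : ℕ),
      H.edges.Nonempty → H.underlying.nestSetWidth ≤ k →
        ∃ F : ExtendedFormulation H.pseudoBooleanPolytope,
          F.numVariables ≤ C * (H.rank * 2 ^ k * Fintype.card V * H.edges.card) ∧
          F.numInequalities ≤ C * (H.rank * 2 ^ k * Fintype.card V * H.edges.card) ∧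
          F.HasUnitCoefficients) ∧
    (∀ (c : ℝ) (p : MvPolynomial (Fin 2) ℕ), ∃ q : MvPolynomial (Fin 2) ℕ,
      ∀ (V : Type u) [Fintype V] [DecidableEq V] (H : SignedHypergraph V) (k : ℕ),
        H.underlying.nestSetWidth ≤ k →
        (k : ℝ) ≤ c * Real.log
          (MvPolynomial.eval ![Fintype.card V, H.underlying.edges.card] p : ℕ) →
          ∃ F : ExtendedFormulation H.pseudoBooleanPolytope,
            F.numVariables ≤ MvPolynomial.eval ![Fintype.card V, H.edges.card] q ∧
            F.numInequalities ≤ MvPolynomial.eval ![Fintype.card V, H.edges.card] q ∧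
            F.HasUnitCoefficients) := by
  constructor
  -- The term `10 (|S| + 1) 2^k |V|` contributes 20 because `|S| ≥ 1`; the remaining `|V| + |S|` or
  -- `2 |S|` contributes 2.
  · refine ⟨22, fun V _ _ H k hS hk => ?_⟩
    obtain ⟨F, h1, h2, h3⟩ := H.exists_extendedFormulation_of_nestSetWidth_le hk
    have hS' : 1 ≤ H.edges.card := hS.card_pos
    have hV : 1 ≤ Fintype.card V := by
      obtain ⟨s, -⟩ := hS
      exact le_trans (by norm_num) (s.two_le_card.trans (Finset.card_le_univ _))
    have hr := H.rank_pos hS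
    have hpow : 1 ≤ 2 ^ k := Nat.one_le_two_pow
    generalize 2 ^ k = t at *
    generalize H.edges.card = a at *
    generalize Fintype.card V = n at *
    have e1 : t * n * a ≤ H.rank * t * n * a := by
      rw [mul_assoc H.rank, mul_assoc H.rank]
      exact Nat.le_mul_of_pos_left _ hr
    have e2 : n * a ≤ t * n * a := by
      rw [mul_assoc]
      exact Nat.le_mul_of_pos_left _ hpow
    have e3 : n ≤ n * a := Nat.le_mul_of_pos_right _ hS'
    have e4 : a ≤ n * a := Nat.le_mul_of_pos_left _ hV
    have e5 : 10 * (a + 1) * t * n ≤ 20 * (t * n * a) := by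
      calc 10 * (a + 1) * t * n ≤ 10 * (a + a) * t * n := by gcongr
        _ = 20 * (t * n * a) := by ring
    exact ⟨F, h1.trans (by omega), h2.trans (by omega), h3⟩
  · intro c p
    -- The sum dominates both size bounds, with `2^k` replaced by its polynomial bound. Evaluating
    -- `p` at `|S|` instead of `|E|` is allowed since `|E| ≤ |S|` and `p` is monotone.
    refine ⟨MvPolynomial.X 0 + 2 * MvPolynomial.X 1 +
      10 * (MvPolynomial.X 1 + 1) * (1 + p ^ ⌈|c|⌉₊) * MvPolynomial.X 0,
      fun V _ _ H k hk hkc => ?_⟩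
    obtain ⟨F, h1, h2, h3⟩ := H.exists_extendedFormulation_of_nestSetWidth_le hk
    have hE : H.underlying.edges.card ≤ H.edges.card := Finset.card_image_le
    have hp : MvPolynomial.eval ![Fintype.card V, H.underlying.edges.card] p ≤
        MvPolynomial.eval ![Fintype.card V, H.edges.card] p := by
      refine p.eval_mono_of_nat fun i => ?_
      fin_cases i
      exacts [le_rfl, hE]
    have h4 : 2 ^ k ≤ 1 + MvPolynomial.eval ![Fintype.card V, H.edges.card] p ^ ⌈|c|⌉₊ :=
      (two_pow_le_of_le_mul_log hkc).trans
        (Nat.add_le_add_left (Nat.pow_le_pow_left hp _) 1)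
    have h5 : 10 * (H.edges.card + 1) * 2 ^ k * Fintype.card V ≤ 10 * (H.edges.card + 1) *
        (1 + MvPolynomial.eval ![Fintype.card V, H.edges.card] p ^ ⌈|c|⌉₊) * Fintype.card V := by
      gcongr
    have h6 : MvPolynomial.eval ![Fintype.card V, H.edges.card]
        (MvPolynomial.X 0 + 2 * MvPolynomial.X 1 +
          10 * (MvPolynomial.X 1 + 1) * (1 + p ^ ⌈|c|⌉₊) * MvPolynomial.X 0) =
        Fintype.card V + 2 * H.edges.card + 10 * (H.edges.card + 1) *
        (1 + MvPolynomial.eval ![Fintype.card V, H.edges.card] p ^ ⌈|c|⌉₊) * Fintype.card V := by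
      simp
    rw [h6]
    exact ⟨F, h1.trans (by omega), h2.trans (by omega), h3⟩
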